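/- Let $n\ge 0$ be an integer and $\alpha>-1$. Let $\mathbb B_n$ be the open unit ball of $\mathbb C^n$, $\nu$ the Lebesgue measure on $\mathbb B_n$ normalized so that $\nu(\mathbb B_n)=1$, and $$d\nu_\alpha(z)=\frac{\Gamma(n+\alpha+1)}{n!\,\Gamma(\alpha+1)}(1-|z|^2)^\alpha\,d\nu(z).$$ For $z,w\in\mathbb B_n$ put $K_w(z)=(1-\langle z,w\rangle)^{-(n+1+\alpha)}$ and $k_w=(1-|w|^2)^{(n+1+\alpha)/2}K_w$, where $\langle z,w\rangle=\sum_j z_j\overline{w_j}$. For $a\in\mathbb B_n\setminus\{0\}$ let $$\varphi_a(z)=\frac{a-P_az-\sqrt{1-|a|^2}\,(z-P_az)}{1-\langle z,a\rangle},\qquad P_az=\frac{\langle z,a\rangle}{|a|^2}a,$$ and let $\varphi_0(z)=-z$. The Berezin transform of $\tau\in L^1(\mathbb B_n,\nu_\alpha)$ is $\widetilde\tau(z)=\int_{\mathbb B_n}|k_z|^2\,\tau\,d\nu_\alpha$, and $\tau\in BMO^1_\alpha(\mathbb B_n,\mathbb C)$ means that $\tau\in L^1(\mathbb B_n,\nu_\alpha)$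 and $\sup_{z\in\mathbb B_n}\|\tau\circ\varphi_z-\widetilde\tau(z)\|_{L^1(\nu_\alpha)}<\infty$. Let $A^2_\alpha(\mathbb B_n,\ell^2)$ be the space of holomorphic functions $\mathbb B_n\to\ell^2$ in $L^2(\nu_\alpha;\ell^2)$, with the $L^2$ norm. For an operator-valued symbol $b\in L^1(\nu_\alpha;\mathcal L(\ell^2))$, the Toeplitz operator $T_b$ is densely defined on $A^2_\alpha(\mathbb B_n,\ell^2)$ by $$T_bf(z)=\int_{\mathbb B_n}b(w)(f(w))\,\overline{K_z(w)}\,d\nu_\alpha(w)$$ for bounded holomorphic $f:\mathbb B_n\to\ell^2$; it is called compact if it extends to a compact linear operator on $A^2_\alpha(\mathbb B_n,\ell^2)$. Let $I$ be the identity of $\ell^2$. 1. Let $\tau\in BMO^1_\alpha(\mathbb B_n,\mathbb C)$ have bounded Berezin transform, $\sup_{z\in\mathbb B_n}|\widetilde\tau(z)|<\infty$. Then $T_{\tau I}$ is not compact on $A^2_\alpha(\mathbb B_n,\ell^2)$ unless $\tau=0$ almost everywhere on $\mathbb B_n$, in which case it is compact. 2. In particular, for $0\le r<1$ and $r\mathbb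 B_n=\{z\in\mathbb C^n:|z|<r\}$, the operator $T_{\chi_{r\mathbb B_n}I}$ is compact if and only if $r=0$. -/

import Mathlib

open MeasureTheory Set
open scoped ENNReal

noncomputable section

namespace BergmanToeplitz

/-- The complex Euclidean space `ℂⁿ` with its Hermitian norm. -/
abbrev Cn (n : ℕ) : Type := EuclideanSpace ℂ (Fin n)

/-- The open unit ball of `ℂⁿ`. -/
def unitBall (n : ℕ) : Set (Cn n) := Metric.ball 0 1

/-- The complex Hilbert space `ℓ²`. -/
abbrev Ell2 : Type := lp (fun _ : ℕ => ℂ) 2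

/-- Lebesgue measure on the unit ball, scaled so that the ball has mass one. -/
def ballMeasure (n : ℕ) : Measure (Cn n) :=
  (volume (unitBall n))⁻¹ • volume.restrict (unitBall n)

/-- The probability measure `dν_α(z) = c_α (1 - |z|²)^α dν(z)` on the unit ball, where
`c_α = Γ(n + α + 1) / (n! Γ(α + 1))`; it is extended by zero outside the ball. -/
def weightedMeasure (n : ℕ) (α : ℝ) : Measure (Cn n) :=
  (ballMeasure n).withDensity fun z =>
    ENNReal.ofReal
      (Real.Gamma (n + α + 1) / (n.factorial * Real.Gamma (α + 1)) * (1 - ‖z‖ ^ 2) ^ α)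

/-- The reproducing kernel `K_w(z) = (1 - ⟨z, w⟩)^{-(n + 1 + α)}`. In Mathlib the inner product
is conjugate linear in the first variable, so that `⟨z, w⟩` is `inner ℂ w z`. For `z, w` in the
ball, `1 - ⟨z, w⟩` lies in the right half plane and the power is the principal one. -/
def kernel {n : ℕ} (α : ℝ) (w z : Cn n) : ℂ :=
  1 / (1 - inner ℂ w z) ^ (((n : ℝ) + 1 + α : ℝ) : ℂ)

/-- The normalized reproducing kernel `k_w(z) = (1 - |w|²)^{(n + 1 + α)/2} K_w(z)`. -/
def normalizedKernel {n : ℕ} (α : ℝ) (w z : Cn n) : ℂ :=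
  (((1 - ‖w‖ ^ 2) ^ (((n : ℝ) + 1 + α) / 2) : ℝ) : ℂ) * kernel α w z

/-- The involutive automorphism `φ_a` of the ball: with `P` the orthogonal projection onto `ℂ a`
and `Q = I - P`, `φ_a(z) = (a - P z - √(1 - |a|²) Q z) / (1 - ⟨z, a⟩)`; and `φ_0(z) = -z`. -/
def ballInvolution {n : ℕ} (a z : Cn n) : Cn n :=
  if a = 0 then -z
  else
    let P : Cn n := (inner ℂ a z / ((‖a‖ ^ 2 : ℝ) : ℂ)) • a
    (1 - inner ℂ a z)⁻¹ • (a - P - ((Real.sqrt (1 - ‖a‖ ^ 2) : ℝ) : ℂ) • (z - P))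

section Banach

variable {n : ℕ} {E F : Type*} [NormedAddCommGroup E] [NormedSpace ℂ E]
  [NormedAddCommGroup F] [NormedSpace ℂ F]

/-- The Berezin transform of a vector-valued function, `z ↦ ∫ |k_z(w)|² b(w) dν_α(w)`. -/
def berezin (α : ℝ) (b : Cn n → E) (z : Cn n) : E :=
  ∫ w, ((‖normalizedKernel α z w‖ ^ 2 : ℝ) : ℂ) • b w ∂(weightedMeasure n α)

/-- The Berezin transform of `b` is bounded on the ball. -/
def BoundedBerezin (α : ℝ) (b : Cn n → E) : Prop :=
  ∃ C : ℝ, ∀ z ∈ unitBall n, ‖berezin α b z‖ ≤ C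

/-- The seminorm `sup_z ‖b ∘ φ_z - b̃(z)‖_{L¹(ν_α)}`, with values in `[0, ∞]`. -/
def bmoSeminorm (α : ℝ) (b : Cn n → E) : ℝ≥0∞ :=
  ⨆ z ∈ unitBall n,
    eLpNorm (fun w => b (ballInvolution z w) - berezin α b z) 1 (weightedMeasure n α)

/-- Membership in `BMO¹_α(𝔹_n, E)`. -/
def MemBMO (α : ℝ) (b : Cn n → E) : Prop :=
  MemLp b 1 (weightedMeasure n α) ∧ bmoSeminorm α b < ∞

variable (n) (E) in
/-- The vector-valued Bergman space `A²_α(𝔹_n, E)`: the subspace of `L²(ν_α; E)` of the classes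
that contain a function holomorphic on the ball, with the `L²` norm. -/
def bergmanSpace (α : ℝ) : Submodule ℂ (Lp E 2 (weightedMeasure n α)) where
  carrier := {g | ∃ f : Cn n → E, DifferentiableOn ℂ f (unitBall n) ∧
    g =ᵐ[weightedMeasure n α] f}
  add_mem' := by
    rintro g₁ g₂ ⟨f₁, hf₁, h₁⟩ ⟨f₂, hf₂, h₂⟩
    exact ⟨f₁ + f₂, hf₁.add hf₂, (Lp.coeFn_add g₁ g₂).trans (h₁.add h₂)⟩
  zero_mem' := ⟨0, differentiableOn_const 0, Lp.coeFn_zero E 2 _⟩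
  smul_mem' := by
    rintro c g ⟨f, hf, h⟩
    exact ⟨c • f, hf.const_smul c, (Lp.coeFn_smul c g).trans (h.const_smul c)⟩

/-- `f` belongs to `H^∞(𝔹_n, E)`: it is holomorphic and bounded on the ball. -/
def IsBoundedHolomorphic (f : Cn n → E) : Prop :=
  DifferentiableOn ℂ f (unitBall n) ∧ ∃ C : ℝ, ∀ z ∈ unitBall n, ‖f z‖ ≤ C

/-- The integral `z ↦ ∫ b(w)(f(w)) conj(K_z(w)) dν_α(w)`. -/
def toeplitzIntegral (α : ℝ) (b : Cn n → E →L[ℂ] F) (f : Cn n → E) (z : Cn n) : F :=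
  ∫ w, (starRingEnd ℂ) (kernel α z w) • b w (f w) ∂(weightedMeasure n α)

/-- The bounded operator `T` on the Bergman space extends the Toeplitz operator with symbol `b`,
which is given on the dense subspace `H^∞` by the Toeplitz integral. -/
def ExtendsToeplitz (α : ℝ) (b : Cn n → E →L[ℂ] F)
    (T : bergmanSpace n E α →L[ℂ] bergmanSpace n F α) : Prop :=
  ∀ (g : bergmanSpace n E α) (f : Cn n → E), IsBoundedHolomorphic f →
    (g : Lp E 2 (weightedMeasure n α)) =ᵐ[weightedMeasure n α] f →
    (T g : Lp F 2 (weightedMeasure n α)) =ᵐ[weightedMeasure n α] toeplitzIntegral α b f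

/-- The densely defined Toeplitz operator with symbol `b` is (that is, extends to) a compact
operator between the Bergman spaces. -/
def ToeplitzIsCompact (α : ℝ) (b : Cn n → E →L[ℂ] F) : Prop :=
  ∃ T : bergmanSpace n E α →L[ℂ] bergmanSpace n F α,
    ExtendsToeplitz α b T ∧ IsCompactOperator T

end Banach

/-- The operator-valued symbol `τ I`, with `I` the identity of `ℓ²`. -/
def scalarSymbol {n : ℕ} (τ : Cn n → ℂ) (z : Cn n) : Ell2 →L[ℂ] Ell2 :=
  τ z • ContinuousLinearMap.id ℂ Ell2

end BergmanToeplitz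

end

/-! Compactness first forces the scalar Toeplitz integral of `τ` to vanish. Let `e i` be the
standard basis of `ℓ²` and `f` bounded holomorphic. The operator sends `f • e i` to `F • e i`, where
`F` is the scalar Toeplitz integral of `f`. These inputs all have the same norm, while the outputs
are mutually at distance at least `‖F • e 0‖`; a compact operator allows this only if `F = 0`
(`ToeplitzIsCompact.ae_integral_kernel_eq_zero`).

It remains to recover `τ` from `F = 0` for every `f` (`ae_eq_zero_of_forall_integral_kernel`).
Expanding the kernel along complex lines through `0` kills all moments of `τ f` against powers of
`⟨ζ, w⟩`, hence also the integral of `τ f` against `exp ⟨ζ, w⟩`. With `f` an exponential of `⟨w,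
t⟩`, the product of exponentials is a unitary character of the underlying real space, so the Fourier
transform of `τ dν_α` is zero and `τ = 0` almost everywhere. -/

/-! ### Uniqueness for Fourier transforms of integrable functions -/

section FourierUniqueness

variable {E : Type*} [NormedAddCommGroup E] [InnerProductSpace ℝ E] [MeasurableSpace E]
  [BorelSpace E] {μ : Measure E}

theorem integrable_exp_inner_mul_I_mul {h : E → ℂ} (hh : Integrable h μ) (t : E) :
    Integrable (fun x => Complex.exp ((inner ℝ x t : ℝ) * Complex.I) * h x) μ := by
  refine hh.bdd_mul (c := 1) ?_ (ae_of_all _ fun x => ?_)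
  · exact (by fun_prop : Continuous fun x : E =>
      Complex.exp ((inner ℝ x t : ℝ) * Complex.I)).measurable.aestronglyMeasurable
  · rw [Complex.norm_exp_ofReal_mul_I]

variable [SecondCountableTopology E] [CompleteSpace E]

/-- The positive and negative parts of `g` are densities of two finite measures with the same
characteristic function, so these measures coincide. -/
theorem ae_eq_zero_of_integral_exp_mul_ofReal_eq_zero {g : E → ℝ} (hg : Integrable g μ)
    (H : ∀ t : E, ∫ x, Complex.exp ((inner ℝ x t : ℝ) * Complex.I) * (g x : ℂ) ∂μ = 0) :
    g =ᵐ[μ] 0 := by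
  have hp : AEMeasurable (fun x => ENNReal.ofReal (g x)) μ := hg.1.aemeasurable.ennreal_ofReal
  have hn : AEMeasurable (fun x => ENNReal.ofReal (-g x)) μ :=
    hg.1.aemeasurable.neg.ennreal_ofReal
  have : IsFiniteMeasure (μ.withDensity fun x => ENNReal.ofReal (g x)) :=
    isFiniteMeasure_withDensity_ofReal hg.2
  have : IsFiniteMeasure (μ.withDensity fun x => ENNReal.ofReal (-g x)) :=
    isFiniteMeasure_withDensity_ofReal hg.neg.2
  have key : (μ.withDensity fun x => ENNReal.ofReal (g x)) =
      μ.withDensity fun x => ENNReal.ofReal (-g x) := by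
    refine Measure.ext_of_charFun (funext fun t => ?_)
    rw [charFun_apply, charFun_apply,
      integral_withDensity_eq_integral_toReal_smul₀ hp (ae_of_all _ fun _ => ENNReal.ofReal_lt_top),
      integral_withDensity_eq_integral_toReal_smul₀ hn (ae_of_all _ fun _ => ENNReal.ofReal_lt_top),
      ← sub_eq_zero, ← integral_sub, ← H t]
    · refine integral_congr_ae (ae_of_all _ fun x => ?_)
      simp only [ENNReal.toReal_ofReal', Complex.real_smul]
      rw [← sub_mul, ← Complex.ofReal_sub, mul_comm]
      congr 2
      rcases le_total (g x) 0 with h | h <;> simp [h]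
    · refine (integrable_exp_inner_mul_I_mul hg.pos_part.ofReal t).congr (ae_of_all _ fun x => ?_)
      simp only [ENNReal.toReal_ofReal', Complex.real_smul]
      rw [mul_comm]
      rfl
    · refine (integrable_exp_inner_mul_I_mul hg.neg_part.ofReal t).congr (ae_of_all _ fun x => ?_)
      simp only [ENNReal.toReal_ofReal', Complex.real_smul]
      rw [mul_comm]
      rfl
  have hfin : ∫⁻ x, ENNReal.ofReal (g x) ∂μ ≠ ∞ := hg.lintegral_lt_top.ne
  filter_upwards [(withDensity_eq_iff hp hn hfin).1 key] with x hx
  have := congrArg ENNReal.toReal hx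
  simp only [ENNReal.toReal_ofReal'] at this
  rcases le_total (g x) 0 with h | h
  · rw [max_eq_right h, max_eq_left (by linarith)] at this
    simp only [Pi.zero_apply]; linarith
  · rw [max_eq_left h, max_eq_right (by linarith)] at this
    exact this

/-- An integrable function whose Fourier transform vanishes is zero almost everywhere. -/
theorem ae_eq_zero_of_integral_exp_mul_eq_zero {h : E → ℂ} (hh : Integrable h μ)
    (H : ∀ t : E, ∫ x, Complex.exp ((inner ℝ x t : ℝ) * Complex.I) * h x ∂μ = 0) :
    h =ᵐ[μ] 0 := by
  -- Conjugating the hypothesis at `-t` handles the conjugate of `h`, and so the real and imaginary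
  -- parts separately.
  have hconj : ∀ t : E, ∫ x, Complex.exp ((inner ℝ x t : ℝ) * Complex.I) *
      (starRingEnd ℂ) (h x) ∂μ = 0 := by
    intro t
    have := congrArg (starRingEnd ℂ) (H (-t))
    rw [← integral_conj, map_zero] at this
    rw [← this]
    refine integral_congr_ae (ae_of_all _ fun x => ?_)
    simp [← Complex.exp_conj]
  have hint := integrable_exp_inner_mul_I_mul hh
  have hcint : Integrable (fun x => (starRingEnd ℂ) (h x)) μ :=
    (Complex.conjCLE : ℂ ≃L[ℝ] ℂ).toContinuousLinearMap.integrable_comp hh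
  have hint' := integrable_exp_inner_mul_I_mul hcint
  have hre : (fun x => (h x).re) =ᵐ[μ] 0 := by
    refine ae_eq_zero_of_integral_exp_mul_ofReal_eq_zero hh.re fun t => ?_
    have : ∀ x, Complex.exp ((inner ℝ x t : ℝ) * Complex.I) * (((h x).re : ℝ) : ℂ) =
        (1 / 2) * (Complex.exp ((inner ℝ x t : ℝ) * Complex.I) * h x +
          Complex.exp ((inner ℝ x t : ℝ) * Complex.I) * (starRingEnd ℂ) (h x)) := by
      intro x
      rw [← mul_add, Complex.add_conj]; push_cast; ring
    simp_rw [this]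
    rw [integral_const_mul, integral_add (hint t) (hint' t), H, hconj]; simp
  have him : (fun x => (h x).im) =ᵐ[μ] 0 := by
    refine ae_eq_zero_of_integral_exp_mul_ofReal_eq_zero hh.im fun t => ?_
    have : ∀ x, Complex.exp ((inner ℝ x t : ℝ) * Complex.I) * (((h x).im : ℝ) : ℂ) =
        (-Complex.I / 2) * (Complex.exp ((inner ℝ x t : ℝ) * Complex.I) * h x -
          Complex.exp ((inner ℝ x t : ℝ) * Complex.I) * (starRingEnd ℂ) (h x)) := by
      intro x
      rw [← mul_sub, Complex.sub_conj]; push_cast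
      linear_combination (Complex.exp ((inner ℝ x t : ℝ) * Complex.I) * (h x).im) *
        Complex.I_mul_I
    simp_rw [this]
    rw [integral_const_mul, integral_sub (hint t) (hint' t), H, hconj]; simp
  filter_upwards [hre, him] with x h1 h2
  exact Complex.ext h1 h2

end FourierUniqueness

/-! ### Moments from binomial series, exponentials from moments -/

section Moments

variable {X : Type*} [MeasurableSpace X] {μ : Measure X}

/-- Up to `k!` this is the rising factorial of `s`, whose roots are nonpositive integers. It lets
moments be read off from binomial series coefficients. -/
theorem choose_add_natCast_sub_one_ne_zero {s : ℝ} (hs : 0 < s) (k : ℕ) :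
    Ring.choose ((s : ℂ) + k - 1) k ≠ 0 := by
  rw [← Ring.multichoose_eq]
  intro h0
  have := Ring.factorial_nsmul_multichoose_eq_ascPochhammer (s : ℂ) k
  rw [h0, smul_zero, Polynomial.ascPochhammer_smeval_cast,
    Polynomial.ascPochhammer_smeval_eq_eval] at this
  obtain ⟨j, -, hj⟩ := (ascPochhammer_eval_eq_zero_iff _ _).1 this.symm
  have := congrArg Complex.re hj
  simp at this
  have : (0 : ℝ) ≤ j := j.cast_nonneg
  linarith

theorem integrable_mul_pow {h u : X → ℂ} (hh : Integrable h μ) (hu : AEStronglyMeasurable u μ)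
    {M : ℝ} (hM : ∀ᵐ x ∂μ, ‖u x‖ ≤ M) (k : ℕ) : Integrable (fun x => h x * u x ^ k) μ := by
  refine hh.mul_bdd (c := M ^ k) (hu.pow k) ?_
  filter_upwards [hM] with x hx
  rw [norm_pow]
  exact pow_le_pow_left₀ (norm_nonneg _) hx k

theorem integral_norm_mul_pow_le {h u : X → ℂ} (hh : Integrable h μ)
    (hu : AEStronglyMeasurable u μ) {M : ℝ} (hM : ∀ᵐ x ∂μ, ‖u x‖ ≤ M) (k : ℕ) :
    ∫ x, ‖h x * u x ^ k‖ ∂μ ≤ M ^ k * ∫ x, ‖h x‖ ∂μ := by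
  rw [← integral_const_mul]
  refine integral_mono_ae (integrable_mul_pow hh hu hM k).norm (hh.norm.const_mul _) ?_
  filter_upwards [hM] with x hx
  rw [norm_mul, norm_pow, mul_comm]
  gcongr

/-- If `∑ c_k x^k` converges absolutely at `R`, then it may be integrated term by term. -/
theorem hasSum_integral_mul_pow {h u : X → ℂ} (hh : Integrable h μ)
    (hu : AEStronglyMeasurable u μ) {R : ℝ} (hR : ∀ᵐ x ∂μ, ‖u x‖ ≤ R) {c : ℕ → ℂ}
    (hc : Summable fun k => ‖c k‖ * R ^ k) {f : ℂ → ℂ}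
    (hf : ∀ z : ℂ, ‖z‖ ≤ R → HasSum (fun k => c k * z ^ k) (f z)) :
    HasSum (fun k => c k * ∫ x, h x * u x ^ k ∂μ) (∫ x, h x * f (u x) ∂μ) := by
  have hint := fun k => (integrable_mul_pow hh hu hR k).const_mul (c k)
  have hsum : Summable fun k => ∫ x, ‖c k * (h x * u x ^ k)‖ ∂μ := by
    refine Summable.of_nonneg_of_le (fun k => integral_nonneg fun x => norm_nonneg _) (fun k => ?_)
      (hc.mul_right (∫ x, ‖h x‖ ∂μ))
    simp_rw [norm_mul (c k)]
    rw [integral_const_mul, mul_assoc]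
    exact mul_le_mul_of_nonneg_left (integral_norm_mul_pow_le hh hu hR k) (norm_nonneg _)
  have := hasSum_integral_of_summable_integral_norm hint hsum
  simp_rw [integral_const_mul] at this
  have heq : ∫ x, h x * f (u x) ∂μ = ∫ x, ∑' k, c k * (h x * u x ^ k) ∂μ := by
    refine integral_congr_ae ?_
    filter_upwards [hR] with x hx
    rw [← ((hf _ hx).mul_left (h x)).tsum_eq]
    congr 1; ext k; ring
  rwa [heq]

theorem hasSum_one_div_one_sub_cpow (s : ℂ) {z : ℂ} (hz : ‖z‖ < 1) :
    HasSum (fun k : ℕ => Ring.choose (s + k - 1) k * z ^ k) (1 / (1 - z) ^ s) := by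
  have := (Complex.one_div_one_sub_cpow_hasFPowerSeriesOnBall_zero s).hasSum (y := z)
    (by
      rw [Metric.mem_eball, edist_zero_right, ← ofReal_norm]
      exact ENNReal.ofReal_lt_one.2 hz)
  simpa [FormalMultilinearSeries.ofScalars, mul_comm] using this

theorem summable_norm_choose_mul_pow (s : ℂ) {R : ℝ} (h0 : 0 ≤ R) (h1 : R < 1) :
    Summable fun k : ℕ => ‖Ring.choose (s + k - 1) k‖ * R ^ k := by
  have := (hasSum_one_div_one_sub_cpow s (z := (R : ℂ)) (by simpa [abs_of_nonneg h0])).summable.norm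
  simpa [abs_of_nonneg h0] using this

/-- If the integrals of `h` against `(1 - t u)^{-s}` vanish for small `t`, then so do the
integrals of `h` against the powers of `u`. -/
theorem integral_mul_pow_eq_zero {h u : X → ℂ} (hh : Integrable h μ)
    (hu : AEStronglyMeasurable u μ) {M : ℝ} (hM : ∀ᵐ x ∂μ, ‖u x‖ ≤ M) {s : ℝ} (hs : 0 < s)
    (H : ∀ᶠ t : ℂ in nhds 0, ∫ x, h x * (1 / (1 - t * u x) ^ (s : ℂ)) ∂μ = 0) (k : ℕ) :
    ∫ x, h x * u x ^ k ∂μ = 0 := by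
  let p : FormalMultilinearSeries ℂ ℂ ℂ := fun k =>
    ContinuousMultilinearMap.mkPiRing ℂ (Fin k)
      (Ring.choose ((s : ℂ) + k - 1) k * ∫ x, h x * u x ^ k ∂μ)
  have hp : ∀ k, p.coeff k = Ring.choose ((s : ℂ) + k - 1) k * ∫ x, h x * u x ^ k ∂μ := by
    intro k; simp [p, FormalMultilinearSeries.coeff]
  have hser : HasFPowerSeriesAt (fun t : ℂ => ∫ x, h x * (1 / (1 - t * u x) ^ (s : ℂ)) ∂μ) p 0 := by
    rw [hasFPowerSeriesAt_iff]
    -- This radius keeps `‖t * u x‖ ≤ 1 / 2`; the `+ 1` covers `M = 0`.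
    have hpos : 0 < 1 / (2 * (|M| + 1)) := by positivity
    filter_upwards [Metric.ball_mem_nhds (0 : ℂ) hpos] with t ht
    rw [mem_ball_zero_iff, lt_div_iff₀ (by positivity)] at ht
    have hR : ∀ᵐ x ∂μ, ‖t * u x‖ ≤ 1 / 2 := by
      filter_upwards [hM] with x hx
      rw [norm_mul]
      have : ‖t‖ * ‖u x‖ ≤ ‖t‖ * (|M| + 1) :=
        mul_le_mul_of_nonneg_left (by linarith [le_abs_self M]) (norm_nonneg _)
      linarith
    have := hasSum_integral_mul_pow hh (hu.const_mul t) hR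
      (summable_norm_choose_mul_pow s (by norm_num) (by norm_num))
      (fun z hz => hasSum_one_div_one_sub_cpow s (by linarith))
    simp only [hp, zero_add, smul_eq_mul]
    have hterm : ∀ k : ℕ, ∫ x, h x * (t * u x) ^ k ∂μ = t ^ k * ∫ x, h x * u x ^ k ∂μ := by
      intro k
      rw [← integral_const_mul]
      congr 1; ext x; ring
    simp_rw [hterm, mul_left_comm _ (t ^ _)] at this
    exact this
  have hp0 := hser.eq_zero_of_eventually H
  have := hp k
  rw [hp0] at this
  have h0 : (0 : FormalMultilinearSeries ℂ ℂ ℂ).coeff k = 0 := by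
    simp [FormalMultilinearSeries.coeff]
  rw [h0] at this
  exact (mul_eq_zero.1 this.symm).resolve_left (choose_add_natCast_sub_one_ne_zero hs k)

theorem integral_mul_exp_eq_zero {h u : X → ℂ} (hh : Integrable h μ)
    (hu : AEStronglyMeasurable u μ) {M : ℝ} (hM : ∀ᵐ x ∂μ, ‖u x‖ ≤ M)
    (H : ∀ k : ℕ, ∫ x, h x * u x ^ k ∂μ = 0) : ∫ x, h x * Complex.exp (u x) ∂μ = 0 := by
  have hM' : ∀ᵐ x ∂μ, ‖u x‖ ≤ |M| := hM.mono fun x hx => hx.trans (le_abs_self M)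
  have hexp : ∀ z : ℂ, HasSum (fun k : ℕ => ((k.factorial : ℂ)⁻¹) * z ^ k) (Complex.exp z) := by
    intro z
    rw [Complex.exp_eq_exp_ℂ]
    simpa using NormedSpace.exp_series_hasSum_exp' (𝕂 := ℂ) z
  have hsum : Summable fun k : ℕ => ‖((k.factorial : ℂ)⁻¹)‖ * |M| ^ k := by
    simpa using (hexp ((|M| : ℝ) : ℂ)).summable.norm
  have := hasSum_integral_mul_pow hh hu hM' hsum (fun z _ => hexp z)
  simp_rw [H, mul_zero] at this
  exact this.unique hasSum_zero

end Moments

/-! ### The weighted measure: null sets and finiteness -/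

namespace BergmanToeplitz

variable {n : ℕ} {α : ℝ}

theorem volume_unitBall_ne_zero (n : ℕ) : volume (unitBall n) ≠ 0 :=
  (Metric.measure_ball_pos volume 0 one_pos).ne'

theorem volume_unitBall_ne_top (n : ℕ) : volume (unitBall n) ≠ ∞ :=
  measure_ball_lt_top.ne

theorem measurableSet_unitBall (n : ℕ) : MeasurableSet (unitBall n) :=
  measurableSet_ball

theorem measurable_weight (n : ℕ) (α : ℝ) : Measurable fun z : Cn n =>
    ENNReal.ofReal
      (Real.Gamma (n + α + 1) / (n.factorial * Real.Gamma (α + 1)) * (1 - ‖z‖ ^ 2) ^ α) := by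
  fun_prop

theorem ae_weightedMeasure_of_ae {p : Cn n → Prop}
    (h : ∀ᵐ z ∂(volume.restrict (unitBall n)), p z) : ∀ᵐ z ∂(weightedMeasure n α), p z := by
  refine (withDensity_absolutelyContinuous _ _).ae_le ?_
  exact (Measure.absolutelyContinuous_of_le_smul le_rfl).ae_le h

/-- The density is strictly positive on the open ball, so no null sets are gained. -/
theorem ae_of_ae_weightedMeasure (hα : -1 < α) {p : Cn n → Prop}
    (h : ∀ᵐ z ∂(weightedMeasure n α), p z) : ∀ᵐ z ∂(volume.restrict (unitBall n)), p z := by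
  have h1 : ∀ᵐ z ∂(ballMeasure n), z ∈ unitBall n :=
    (Measure.absolutelyContinuous_of_le_smul le_rfl).ae_le
      (ae_restrict_mem (measurableSet_unitBall n))
  have h2 : ∀ᵐ z ∂(ballMeasure n), p z := by
    filter_upwards [(ae_withDensity_iff (measurable_weight n α)).1 h, h1] with z hz hzb
    refine hz ?_
    rw [unitBall, mem_ball_zero_iff] at hzb
    have : 0 < 1 - ‖z‖ ^ 2 := by nlinarith [norm_nonneg z]
    have hn : (0 : ℝ) ≤ n := n.cast_nonneg
    have g1 := Real.Gamma_pos_of_pos (show 0 < n + α + 1 by linarith)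
    have g2 := Real.Gamma_pos_of_pos (show 0 < α + 1 by linarith)
    have := Real.rpow_pos_of_pos this α
    rw [Ne, ENNReal.ofReal_eq_zero, not_le]
    positivity
  rw [ballMeasure, Measure.ae_ennreal_smul_measure_iff] at h2
  · exact h2
  · exact ENNReal.inv_ne_zero.2 (volume_unitBall_ne_top n)

theorem ae_mem_unitBall : ∀ᵐ z ∂(weightedMeasure n α), z ∈ unitBall n :=
  ae_weightedMeasure_of_ae (ae_restrict_mem (measurableSet_unitBall n))

/-- Factor `1 - y ^ 2 = (1 - y) * (1 + y)`: the first factor carries the singularity, integrable for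
`α > -1`, and the second has a bounded power. -/
theorem integrableOn_one_sub_sq_rpow (hα : -1 < α) :
    IntegrableOn (fun y : ℝ => (1 - y ^ 2) ^ α) (Ioo 0 1) := by
  have h1 : IntegrableOn (fun y : ℝ => (1 - y) ^ α) (Ioo 0 1) := by
    have := (intervalIntegral.intervalIntegrable_rpow' (a := 0) (b := 1) hα).comp_sub_left 1
    simp only [sub_zero, sub_self] at this
    exact ((intervalIntegrable_iff_integrableOn_Ioc_of_le zero_le_one).1 this.symm).mono_set
      Ioo_subset_Ioc_self
  have h2 : IntegrableOn (fun y : ℝ => (1 - y) ^ α * (1 + y) ^ α) (Ioo 0 1) := by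
    refine Integrable.mul_bdd (c := 2 ^ |α|) h1 ?_ ?_
    · exact (by fun_prop : Measurable fun y : ℝ => (1 + y) ^ α).aestronglyMeasurable
    · refine (ae_restrict_mem measurableSet_Ioo).mono fun y hy => ?_
      have hy1 : 1 ≤ 1 + y := by linarith [hy.1]
      rw [Real.norm_of_nonneg (by positivity)]
      calc (1 + y) ^ α ≤ (1 + y) ^ |α| := Real.rpow_le_rpow_of_exponent_le hy1 (le_abs_self α)
        _ ≤ 2 ^ |α| := Real.rpow_le_rpow (by linarith) (by linarith [hy.2]) (abs_nonneg α)
  refine h2.congr_fun (fun y hy => ?_) measurableSet_Ioo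
  dsimp only
  rw [← Real.mul_rpow (by linarith [hy.2]) (by linarith [hy.1])]
  ring_nf

theorem integrableOn_one_sub_norm_sq_rpow (n : ℕ) (hα : -1 < α) :
    IntegrableOn (fun z : Cn n => (1 - ‖z‖ ^ 2) ^ α) (unitBall n) := by
  -- Polar coordinates need a nontrivial space; for `n = 0` the ball is a point.
  rcases subsingleton_or_nontrivial (Cn n) with hs | hs
  · have : (fun z : Cn n => (1 - ‖z‖ ^ 2) ^ α) = fun _ => 1 := by
      ext z; simp [Subsingleton.elim z 0]
    rw [this]
    exact integrableOn_const (volume_unitBall_ne_top n)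
  · rw [← integrable_indicator_iff (measurableSet_unitBall n)]
    have key := (integrable_fun_norm_addHaar (volume : Measure (Cn n))
      (f := (Iio (1 : ℝ)).indicator fun y => (1 - y ^ 2) ^ α)).2 ?_
    · refine key.congr (ae_of_all _ fun z => ?_)
      beta_reduce
      by_cases hz : ‖z‖ < 1
      · rw [indicator_of_mem (show ‖z‖ ∈ Iio 1 from hz),
          indicator_of_mem (show z ∈ unitBall n from mem_ball_zero_iff.2 hz)]
      · rw [indicator_of_notMem (show ‖z‖ ∉ Iio 1 from hz),
          indicator_of_notMem (show z ∉ unitBall n from fun h => hz (mem_ball_zero_iff.1 h))]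
    · have h3 : IntegrableOn (fun y : ℝ =>
          y ^ (Module.finrank ℝ (Cn n) - 1) * (1 - y ^ 2) ^ α) (Ioo 0 1) := by
        refine Integrable.bdd_mul (c := 1) (integrableOn_one_sub_sq_rpow hα) ?_ ?_
        · exact (by fun_prop : Continuous fun y : ℝ =>
            y ^ (Module.finrank ℝ (Cn n) - 1)).aestronglyMeasurable
        · refine (ae_restrict_mem measurableSet_Ioo).mono fun y hy => ?_
          rw [norm_pow, Real.norm_of_nonneg hy.1.le]
          exact pow_le_one₀ hy.1.le hy.2.le
      have h4 : (fun y : ℝ => y ^ (Module.finrank ℝ (Cn n) - 1) •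
          (Iio (1 : ℝ)).indicator (fun y => (1 - y ^ 2) ^ α) y) = (Iio (1 : ℝ)).indicator
            (fun y : ℝ => y ^ (Module.finrank ℝ (Cn n) - 1) * (1 - y ^ 2) ^ α) := by
        ext y
        by_cases hy : y ∈ Iio (1 : ℝ) <;> simp [hy]
      rw [h4, IntegrableOn, integrable_indicator_iff measurableSet_Iio, IntegrableOn,
        Measure.restrict_restrict measurableSet_Iio, Iio_inter_Ioi]
      exact h3

theorem isFiniteMeasure_weightedMeasure (n : ℕ) (hα : -1 < α) :
    IsFiniteMeasure (weightedMeasure n α) := by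
  refine isFiniteMeasure_withDensity_ofReal (Integrable.const_mul ?_ _).2
  refine Integrable.smul_measure (integrableOn_one_sub_norm_sq_rpow n hα) ?_
  exact ENNReal.inv_ne_top.2 (volume_unitBall_ne_zero n)

/-! ### Bounded holomorphic functions -/

section BoundedHolomorphic

variable {E : Type*} [NormedAddCommGroup E] [NormedSpace ℂ E]

theorem IsBoundedHolomorphic.aestronglyMeasurable {f : Cn n → E} (hf : IsBoundedHolomorphic f) :
    AEStronglyMeasurable f (weightedMeasure n α) := by
  have h := hf.1.continuousOn.aestronglyMeasurable (μ := volume) (measurableSet_unitBall n)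
  exact h.mono_ac fun s hs => ae_weightedMeasure_of_ae (p := fun z => z ∉ s)
    (measure_eq_zero_iff_ae_notMem.1 hs) |> measure_eq_zero_iff_ae_notMem.2

theorem IsBoundedHolomorphic.exists_mem_bergmanSpace (hα : -1 < α) {f : Cn n → E}
    (hf : IsBoundedHolomorphic f) : ∃ g : bergmanSpace n E α,
      (g : Lp E 2 (weightedMeasure n α)) =ᵐ[weightedMeasure n α] f := by
  have := isFiniteMeasure_weightedMeasure n hα
  obtain ⟨C, hC⟩ := hf.2
  have hL : MemLp f 2 (weightedMeasure n α) :=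
    MemLp.of_bound hf.aestronglyMeasurable C (ae_mem_unitBall.mono hC)
  exact ⟨⟨hL.toLp f, f, hf.1, hL.coeFn_toLp⟩, hL.coeFn_toLp⟩

theorem IsBoundedHolomorphic.smul_const {f : Cn n → ℂ} (hf : IsBoundedHolomorphic f) (v : E) :
    IsBoundedHolomorphic fun w => f w • v := by
  obtain ⟨hd, C, hC⟩ := hf
  refine ⟨hd.smul_const v, C * ‖v‖, fun z hz => ?_⟩
  rw [norm_smul]
  exact mul_le_mul_of_nonneg_right (hC z hz) (norm_nonneg v)

theorem IsBoundedHolomorphic.integrable_mul {τ f : Cn n → ℂ} (hf : IsBoundedHolomorphic f)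
    (hτ : Integrable τ (weightedMeasure n α)) :
    Integrable (fun w => τ w * f w) (weightedMeasure n α) := by
  obtain ⟨C, hC⟩ := hf.2
  exact hτ.mul_bdd hf.aestronglyMeasurable (ae_mem_unitBall.mono hC)

theorem isBoundedHolomorphic_exp_inner (c : ℂ) (t : Cn n) :
    IsBoundedHolomorphic fun w : Cn n => Complex.exp (c * inner ℂ t w) := by
  refine ⟨?_, Real.exp (‖c‖ * ‖t‖), fun z hz => ?_⟩
  · have : Differentiable ℂ fun w : Cn n => inner ℂ t w := (innerSL ℂ t).differentiable
    exact (this.const_mul c).cexp.differentiableOn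
  · rw [unitBall, mem_ball_zero_iff] at hz
    refine (Complex.norm_exp_le_exp_norm _).trans (Real.exp_le_exp.2 ?_)
    rw [norm_mul]
    refine mul_le_mul_of_nonneg_left ((norm_inner_le_norm _ _).trans ?_) (norm_nonneg c)
    exact mul_le_of_le_one_right (norm_nonneg t) hz.le

end BoundedHolomorphic

/-! ### The symbol is determined by its scalar Toeplitz integrals -/

section Kernel

/-- Restricting `z` to radius `1 / 2` keeps the base of the kernel away from the branch cut and from
`0`, uniformly in `w`. -/
theorem half_le_re_one_sub_inner {w z : Cn n} (hw : ‖w‖ < 1) (hz : ‖z‖ < 1 / 2) :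
    1 / 2 ≤ (1 - inner ℂ w z).re := by
  have h1 : ‖inner ℂ w z‖ ≤ ‖w‖ * ‖z‖ := norm_inner_le_norm w z
  have h2 := Complex.re_le_norm (inner ℂ w z)
  rw [Complex.sub_re, Complex.one_re]
  nlinarith [norm_nonneg w, norm_nonneg z]

theorem conj_kernel {w z : Cn n} (hw : ‖w‖ < 1) (hz : ‖z‖ < 1 / 2) :
    (starRingEnd ℂ) (kernel α z w) =
      1 / (1 - inner ℂ w z) ^ (((n : ℝ) + 1 + α : ℝ) : ℂ) := by
  have harg : (1 - inner ℂ w z).arg ≠ Real.pi := by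
    have := half_le_re_one_sub_inner hw hz
    exact (Complex.mem_slitPlane_iff_arg.1 (Or.inl (by linarith))).1
  have := Complex.cpow_conj (1 - inner ℂ w z) (((n : ℝ) + 1 + α : ℝ) : ℂ) harg
  rw [Complex.conj_ofReal, map_sub, map_one, inner_conj_symm] at this
  rw [kernel, map_div₀, map_one, ← this]

theorem norm_one_div_cpow_le {x : ℂ} (hx : 1 / 2 ≤ x.re) {s : ℝ} (hs : 0 ≤ s) :
    ‖1 / x ^ (s : ℂ)‖ ≤ 2 ^ s := by
  have h : 1 / 2 ≤ ‖x‖ := hx.trans (Complex.re_le_norm x)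
  rw [norm_div, norm_one, Complex.norm_cpow_real, one_div, ← Real.inv_rpow (norm_nonneg x)]
  refine Real.rpow_le_rpow (by positivity) ?_ hs
  rw [inv_le_comm₀ (by linarith) two_pos]
  linarith

theorem continuousOn_integral_one_div_one_sub_inner_cpow {h : Cn n → ℂ}
    (hh : Integrable h (weightedMeasure n α)) {s : ℝ} (hs : 0 ≤ s) :
    ContinuousOn (fun z : Cn n => ∫ w, h w * (1 / (1 - inner ℂ w z) ^ (s : ℂ))
      ∂(weightedMeasure n α)) (Metric.ball 0 (1 / 2)) := by
  refine continuousOn_of_dominated (bound := fun w => ‖h w‖ * 2 ^ s) (fun z _ => ?_)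
    (fun z hz => ?_) (hh.norm.mul_const _) ?_
  · refine hh.1.mul (Measurable.aestronglyMeasurable ?_)
    have : Continuous fun w : Cn n => inner ℂ w z := by fun_prop
    have := this.measurable
    fun_prop
  · filter_upwards [ae_mem_unitBall] with w hw
    rw [norm_mul]
    exact mul_le_mul_of_nonneg_left (norm_one_div_cpow_le (half_le_re_one_sub_inner
      (mem_ball_zero_iff.1 hw) (mem_ball_zero_iff.1 hz)) hs) (norm_nonneg _)
  · filter_upwards [ae_mem_unitBall] with w hw
    intro z hz
    have hre := half_le_re_one_sub_inner (mem_ball_zero_iff.1 hw) (mem_ball_zero_iff.1 hz)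
    have hslit : 1 - inner ℂ w z ∈ Complex.slitPlane := Or.inl (by linarith)
    refine ContinuousAt.continuousWithinAt (continuousAt_const.mul (continuousAt_const.div ?_ ?_))
    · exact ContinuousAt.cpow (by fun_prop) continuousAt_const hslit
    · rw [Complex.cpow_ne_zero_iff]
      exact Or.inl (Complex.slitPlane_ne_zero hslit)

theorem ae_eq_zero_of_forall_integral_kernel (hα : -1 < α) {τ : Cn n → ℂ}
    (hτ : Integrable τ (weightedMeasure n α))
    (H : ∀ f : Cn n → ℂ, IsBoundedHolomorphic f → ∀ᵐ z ∂(weightedMeasure n α),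
      ∫ w, (starRingEnd ℂ) (kernel α z w) * (τ w * f w) ∂(weightedMeasure n α) = 0) :
    τ =ᵐ[weightedMeasure n α] 0 := by
  have hs : 0 < (n : ℝ) + 1 + α := by
    have : (0 : ℝ) ≤ n := n.cast_nonneg
    linarith
  have hinner : ∀ ζ : Cn n, AEStronglyMeasurable (fun w : Cn n => inner ℂ w ζ)
      (weightedMeasure n α) := fun ζ =>
    (by fun_prop : Continuous fun w : Cn n => inner ℂ w ζ).measurable.aestronglyMeasurable
  have hbound : ∀ ζ : Cn n, ∀ᵐ w ∂(weightedMeasure n α), ‖inner ℂ w ζ‖ ≤ ‖ζ‖ := fun ζ => by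
    filter_upwards [ae_mem_unitBall] with w hw
    exact (norm_inner_le_norm _ _).trans
      (mul_le_of_le_one_left (norm_nonneg ζ) (mem_ball_zero_iff.1 hw).le)
  have hexp : ∀ f : Cn n → ℂ, IsBoundedHolomorphic f → ∀ ζ : Cn n,
      ∫ w, τ w * f w * Complex.exp (inner ℂ w ζ) ∂(weightedMeasure n α) = 0 := by
    intro f hf ζ
    have hh := hf.integrable_mul hτ
    refine integral_mul_exp_eq_zero hh (hinner ζ) (hbound ζ)
      (integral_mul_pow_eq_zero hh (hinner ζ) (hbound ζ) hs ?_)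
    have hsub : Metric.ball (0 : Cn n) (1 / 2) ⊆ unitBall n :=
      Metric.ball_subset_ball (by norm_num)
    have hzero : EqOn (fun z : Cn n => ∫ w, τ w * f w *
        (1 / (1 - inner ℂ w z) ^ (((n : ℝ) + 1 + α : ℝ) : ℂ)) ∂(weightedMeasure n α)) 0
        (Metric.ball 0 (1 / 2)) := by
      -- Continuity upgrades almost everywhere vanishing to every point, which is needed to restrict
      -- to the null set of a complex line.
      refine Measure.eqOn_open_of_ae_eq (μ := volume) ?_ Metric.isOpen_ball
        (continuousOn_integral_one_div_one_sub_inner_cpow hh hs.le) continuousOn_const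
      filter_upwards [ae_restrict_of_ae_restrict_of_subset hsub
        (ae_of_ae_weightedMeasure hα (H f hf)), ae_restrict_mem measurableSet_ball] with z hz hzb
      rw [Pi.zero_apply, ← hz]
      refine integral_congr_ae ?_
      filter_upwards [ae_mem_unitBall] with w hw
      rw [conj_kernel (mem_ball_zero_iff.1 hw) (mem_ball_zero_iff.1 hzb), mul_comm]
    have hcont : Filter.Tendsto (fun t : ℂ => t • ζ) (nhds 0) (nhds 0) := by
      have : Continuous fun t : ℂ => t • ζ := by fun_prop
      simpa using this.tendsto 0
    filter_upwards [hcont (Metric.ball_mem_nhds 0 (by norm_num : (0 : ℝ) < 1 / 2))] with t ht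
    have := hzero ht
    simpa only [inner_smul_right, Pi.zero_apply] using this
  refine ae_eq_zero_of_integral_exp_mul_eq_zero hτ fun t => ?_
  -- The factors `I / 2` make the exponents add up to `I` times the real part of `⟨w, t⟩`, which is
  -- the real inner product.
  rw [← hexp _ (isBoundedHolomorphic_exp_inner (Complex.I / 2) t) ((Complex.I / 2) • t)]
  refine integral_congr_ae (ae_of_all _ fun w => ?_)
  beta_reduce
  have hre : ((inner ℝ w t : ℝ) : ℂ) = (inner ℂ w t + inner ℂ t w) / 2 := by
    rw [← inner_conj_symm t w, Complex.add_conj]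
    have : inner ℝ w t = (inner ℂ w t).re := by
      simp [PiLp.inner_apply, Complex.inner]
    rw [this]; push_cast; ring
  rw [mul_assoc, ← Complex.exp_add, mul_comm, inner_smul_right, hre]
  congr 2
  ring

end Kernel

/-! ### Compactness and the basis of `ℓ²` -/

section Compactness

theorem toeplitzIntegral_scalarSymbol_smul_const (τ f : Cn n → ℂ) (v : Ell2) (z : Cn n) :
    toeplitzIntegral α (scalarSymbol τ) (fun w => f w • v) z =
      (∫ w, (starRingEnd ℂ) (kernel α z w) * (τ w * f w) ∂(weightedMeasure n α)) • v := by
  have h : ∀ w, (starRingEnd ℂ) (kernel α z w) • scalarSymbol τ w (f w • v) =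
      ((starRingEnd ℂ) (kernel α z w) * (τ w * f w)) • v := fun w => by
    simp only [scalarSymbol, smul_apply, ContinuousLinearMap.id_apply, smul_smul]
  simp only [toeplitzIntegral, h]
  exact integral_smul_const _ v

/-- Read off the `i`-th coordinate. The exact value `√2` is not needed, only a comparison with the
unit norm of `e 0`. -/
theorem one_le_norm_single_sub_single {i j : ℕ} (hij : i ≠ j) :
    1 ≤ ‖(lp.single 2 i 1 - lp.single 2 j 1 : Ell2)‖ := by
  have := lp.norm_apply_le_norm (p := 2) (by norm_num)
    (lp.single 2 i 1 - lp.single 2 j 1 : Ell2) i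
  simpa [lp.single_apply, hij] using this

theorem norm_single_one (i : ℕ) : ‖(lp.single 2 i 1 : Ell2)‖ = 1 := by
  rw [lp.norm_single (by norm_num)]; simp

/-- A compact operator cannot separate uniformly the terms of a bounded sequence. -/
theorem _root_.IsCompactOperator.exists_dist_lt {V W : Type*} [NormedAddCommGroup V]
    [NormedSpace ℂ V] [NormedAddCommGroup W] [NormedSpace ℂ W] {T : V →L[ℂ] W}
    (hT : IsCompactOperator T) {g : ℕ → V} {R : ℝ} (hg : ∀ i, ‖g i‖ ≤ R) {ε : ℝ} (hε : 0 < ε) :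
    ∃ i j, i ≠ j ∧ dist (T (g i)) (T (g j)) < ε := by
  have hc := hT.isCompact_closure_image_closedBall (f := (T : V →ₗ[ℂ] W)) R
  obtain ⟨a, -, φ, hφ, hlim⟩ := hc.tendsto_subseq (x := fun i => T (g i)) fun i =>
    subset_closure ⟨g i, mem_closedBall_zero_iff.2 (hg i), rfl⟩
  obtain ⟨N, hN⟩ := Metric.cauchySeq_iff.1 hlim.cauchySeq ε hε
  exact ⟨φ N, φ (N + 1), (hφ (Nat.lt_succ_self N)).ne, hN N le_rfl (N + 1) (Nat.le_succ N)⟩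

theorem norm_le_norm_sub_of_ae_eq_smul {X E : Type*} [MeasurableSpace X] {μ : Measure X}
    [NormedAddCommGroup E] [NormedSpace ℂ E] {p : ℝ≥0∞} {G G₁ G₂ : Lp E p μ} {F : X → ℂ}
    {v v₁ v₂ : E} (hG : G =ᵐ[μ] fun x => F x • v) (hG₁ : G₁ =ᵐ[μ] fun x => F x • v₁)
    (hG₂ : G₂ =ᵐ[μ] fun x => F x • v₂) (hv : ‖v‖ ≤ ‖v₁ - v₂‖) : ‖G‖ ≤ ‖G₁ - G₂‖ := by
  refine Lp.norm_le_norm_of_ae_le ?_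
  filter_upwards [hG, hG₁, hG₂, Lp.coeFn_sub G₁ G₂] with x h h₁ h₂ hs
  rw [hs, Pi.sub_apply, h, h₁, h₂, ← smul_sub, norm_smul, norm_smul]
  exact mul_le_mul_of_nonneg_left hv (norm_nonneg _)

theorem ToeplitzIsCompact.ae_integral_kernel_eq_zero (hα : -1 < α) {τ : Cn n → ℂ}
    (hT : ToeplitzIsCompact α (scalarSymbol τ)) {f : Cn n → ℂ} (hf : IsBoundedHolomorphic f) :
    ∀ᵐ z ∂(weightedMeasure n α),
      ∫ w, (starRingEnd ℂ) (kernel α z w) * (τ w * f w) ∂(weightedMeasure n α) = 0 := by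
  obtain ⟨T, hext, hcomp⟩ := hT
  set F : Cn n → ℂ := fun z =>
    ∫ w, (starRingEnd ℂ) (kernel α z w) * (τ w * f w) ∂(weightedMeasure n α)
  let e : ℕ → Ell2 := fun i => lp.single 2 i 1
  choose g hg using fun i => (hf.smul_const (e i)).exists_mem_bergmanSpace hα
  have hTg : ∀ i, (T (g i) : Lp Ell2 2 (weightedMeasure n α)) =ᵐ[weightedMeasure n α]
      fun z => F z • e i := fun i => by
    refine (hext (g i) _ (hf.smul_const (e i)) (hg i)).trans (ae_of_all _ fun z => ?_)
    exact toeplitzIntegral_scalarSymbol_smul_const τ f (e i) z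
  have hbound : ∀ i, ‖g i‖ ≤ ‖g 0‖ := fun i => by
    refine Lp.norm_le_norm_of_ae_le (f := (g i : Lp Ell2 2 (weightedMeasure n α)))
      (g := (g 0 : Lp Ell2 2 (weightedMeasure n α))) ?_
    filter_upwards [hg i, hg 0] with z h1 h2
    rw [h1, h2, norm_smul, norm_smul, norm_single_one, norm_single_one]
  have hsep : ∀ i j, i ≠ j → ‖T (g 0)‖ ≤ dist (T (g i)) (T (g j)) := fun i j hij => by
    rw [Subtype.dist_eq, dist_eq_norm]
    exact norm_le_norm_sub_of_ae_eq_smul (hTg 0) (hTg i) (hTg j)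
      (by rw [norm_single_one]; exact one_le_norm_single_sub_single hij)
  -- Otherwise `‖T (g 0)‖` is a positive separation for the images of a bounded sequence.
  have hzero : T (g 0) = 0 := by
    by_contra hne
    obtain ⟨i, j, hij, hlt⟩ := hcomp.exists_dist_lt hbound (norm_pos_iff.2 hne)
    exact absurd (hsep i j hij) (not_le.2 hlt)
  have h0 := hTg 0
  rw [hzero] at h0
  filter_upwards [h0, Lp.coeFn_zero Ell2 2 (weightedMeasure n α)] with z h1 h2
  have h3 : F z • e 0 = 0 := by rw [← h1]; exact h2
  refine (smul_eq_zero.1 h3).resolve_right fun he => ?_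
  have := norm_single_one 0
  rw [show (lp.single 2 0 1 : Ell2) = 0 from he, norm_zero] at this
  exact zero_ne_one this

/-- The zero operator is an extension. -/
theorem toeplitzIsCompact_of_ae_eq_zero {τ : Cn n → ℂ} (hτ : τ =ᵐ[weightedMeasure n α] 0) :
    ToeplitzIsCompact α (scalarSymbol τ) := by
  refine ⟨0, fun g f _ _ => ?_, isCompactOperator_zero⟩
  have : toeplitzIntegral α (scalarSymbol τ) f = 0 := by
    ext1 z
    refine integral_eq_zero_of_ae ?_
    filter_upwards [hτ] with w hw
    simp [scalarSymbol, hw]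
  rw [this]
  exact Lp.coeFn_zero Ell2 2 (weightedMeasure n α)

theorem toeplitzIsCompact_scalarSymbol_iff (hα : -1 < α) {τ : Cn n → ℂ}
    (hτ : Integrable τ (weightedMeasure n α)) : ToeplitzIsCompact α (scalarSymbol τ) ↔
      ∀ᵐ z ∂(volume.restrict (unitBall n)), τ z = 0 := by
  refine ⟨fun hT => ?_, fun h => toeplitzIsCompact_of_ae_eq_zero (ae_weightedMeasure_of_ae h)⟩
  exact ae_of_ae_weightedMeasure hα (ae_eq_zero_of_forall_integral_kernel hα hτ
    fun f hf => hT.ae_integral_kernel_eq_zero hα hf)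

end Compactness

end BergmanToeplitz

theorem proposition2p4 (n : ℕ) (α : ℝ) (hα : -1 < α) :
    (∀ τ : BergmanToeplitz.Cn n → ℂ,
      BergmanToeplitz.MemBMO α τ → BergmanToeplitz.BoundedBerezin α τ →
        (BergmanToeplitz.ToeplitzIsCompact α (BergmanToeplitz.scalarSymbol τ) ↔
          ∀ᵐ z ∂(volume.restrict (BergmanToeplitz.unitBall n)), τ z = 0)) ∧
    (∀ r : ℝ, 0 ≤ r → r < 1 →
      (BergmanToeplitz.ToeplitzIsCompact α
          (BergmanToeplitz.scalarSymbol
            ((Metric.ball (0 : BergmanToeplitz.Cn n) r).indicator fun _ => (1 : ℂ))) ↔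
        r = 0)) := by
  refine ⟨fun τ hτ _ => BergmanToeplitz.toeplitzIsCompact_scalarSymbol_iff hα
    (memLp_one_iff_integrable.1 hτ.1), fun r hr hr1 => ?_⟩
  have := BergmanToeplitz.isFiniteMeasure_weightedMeasure n hα
  rw [BergmanToeplitz.toeplitzIsCompact_scalarSymbol_iff hα
    ((integrable_const (1 : ℂ)).indicator measurableSet_ball)]
  constructor
  · intro h
    by_contra hne
    have hsub : Metric.ball (0 : BergmanToeplitz.Cn n) r ⊆ BergmanToeplitz.unitBall n :=
      Metric.ball_subset_ball hr1.le
    -- The indicator is `1` on a ball of positive radius, which would then be null.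
    have h1 : ∀ᵐ z ∂(volume.restrict (Metric.ball (0 : BergmanToeplitz.Cn n) r)), False := by
      filter_upwards [ae_restrict_of_ae_restrict_of_subset hsub h,
        ae_restrict_mem measurableSet_ball] with z hz hzb
      rw [indicator_of_mem hzb] at hz
      exact one_ne_zero hz
    rw [Filter.eventually_false_iff_eq_bot, ae_eq_bot, Measure.restrict_eq_zero] at h1
    exact (Metric.measure_ball_pos volume (0 : BergmanToeplitz.Cn n)
      (lt_of_le_of_ne hr (Ne.symm hne))).ne' h1
  · rintro rfl
    simp
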